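/- Fix a finite alphabet $\Sigma$. A word $w=w_1\cdots w_\ell\in\Sigma^\star$ is viewed as the structure with domain $\{1,\dots,\ell\}$ (empty if $w=\varepsilon$), the order $<$, and the unary predicates $Q_a=\{i : w_i=a\}$ for $a\in\Sigma$. $\mathrm{FO}^2[<]$ is the set of first-order sentences over $<$, $=$ and the $Q_a$ that use only two variables $x,y$ (each of which may be requantified); there are no constants for truth and falsity. For $m\le n$, $\mathrm{FO}^2_{m,n}[<]$ consists of those sentences that have quantifier depth at most $n$ and in which, once negations are pushed to the atoms, every path in the parse tree has at most $m$ blocks of alternating quantifiers; $\mathrm{FO}^2_m[<]=\bigcup_{n\ge m}\mathrm{FO}^2_{m,n}[<]$. A sentence $\varphi$ *separates* languages $K,L\subseteq\Sigma^\star$ if $\varphi$ holds in all words of $K$ and in no word of $L$, or vice versa. Over the alphabets $\Sigma_m=\{a_0,\dots,a_{m-1}\}$ define, for $n,i\ge 1$, $$u_{1,n}=a_0,\quad v_{1,n}=\varepsilon,\qquad u_{2,n}=a_0(a_1a_0)^{2n},\quad v_{2,n}=(a_1a_0)^{2n},$$ $$u_{2i+1,n}=(a_0\cdots a_{2i})^n\,u_{2i,n},\qquad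 v_{2i+1,n}=(a_0\cdots a_{2i})^n\,v_{2i,n},$$ $$u_{2i+2,n}=u_{2i+1,n}\,(a_{2i+1}\cdots a_0)^n,\qquad v_{2i+2,n}=v_{2i+1,n}\,(a_{2i+1}\cdots a_0)^n,$$ and $K_m=\{u_{m,n} : n\ge 1\}$, $L_m=\{v_{m,n} : n\ge 1\}$. **Theorem (alternation hierarchy for $\mathrm{FO}^2[<]$).** For every integer $m\ge 1$, over the alphabet $\Sigma_m$, there is a sentence $\varphi_m\in\mathrm{FO}^2_m[<]$ that separates $K_m$ and $L_m$, but no sentence $\psi\in\mathrm{FO}^2_{m-1}[<]$ separates $K_m$ and $L_m$. Consequently the quantifier alternation hierarchy of $\mathrm{FO}^2[<]$ is strict: for every $m\ge1$, the class of languages over $\Sigma_m$ definable in $\mathrm{FO}^2_{m-1}[<]$ is properly contained in the class of those definable in $\mathrm{FO}^2_m[<]$. -/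

import Mathlib

namespace FO2

/-- First-order formulas over the signature `<`, `=`, `Q_a` (`a` in the alphabet `A`), in which only
the two variables `0` and `1` (usually written `x` and `y`) occur. There are no logical constants
for truth and falsity. -/
inductive Formula (A : Type) : Type
  | letter (a : A) (v : Fin 2) : Formula A
  | lt (v v' : Fin 2) : Formula A
  | eq (v v' : Fin 2) : Formula A
  | neg (φ : Formula A) : Formula A
  | and (φ ψ : Formula A) : Formula A
  | or (φ ψ : Formula A) : Formula A
  | ex (v : Fin 2) (φ : Formula A) : Formula A
  | all (v : Fin 2) (φ : Formula A) : Formula A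

namespace Formula

variable {A : Type}

/-- Satisfaction in the word `w`, whose positions are `0, …, w.length - 1`, under the assignment
`s`. Quantifiers range over the positions of `w`; an empty word has none. -/
def Realize (w : List A) : (Fin 2 → ℕ) → Formula A → Prop
  | s, letter a v => w[s v]? = some a
  | s, lt v v' => s v < s v'
  | s, eq v v' => s v = s v'
  | s, neg φ => ¬ Realize w s φ
  | s, and φ ψ => Realize w s φ ∧ Realize w s ψ
  | s, or φ ψ => Realize w s φ ∨ Realize w s ψ
  | s, ex v φ => ∃ i < w.length, Realize w (Function.update s v i) φ
  | s, all v φ => ∀ i < w.length, Realize w (Function.update s v i) φ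

/-- The free variables of a formula. -/
def freeVars : Formula A → Finset (Fin 2)
  | letter _ v => {v}
  | lt v v' => {v, v'}
  | eq v v' => {v, v'}
  | neg φ => freeVars φ
  | and φ ψ => freeVars φ ∪ freeVars ψ
  | or φ ψ => freeVars φ ∪ freeVars ψ
  | ex v φ => (freeVars φ).erase v
  | all v φ => (freeVars φ).erase v

/-- A sentence is a formula without free variables. -/
def IsSentence (φ : Formula A) : Prop := φ.freeVars = ∅

/-- Satisfaction of a sentence in a word. Both variables are initially at the first position; the
truth value of a sentence does not depend on this choice. -/
def Models (w : List A) (φ : Formula A) : Prop := φ.Realize w (fun _ => 0)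

/-- Quantifier depth. -/
def depth : Formula A → ℕ
  | letter _ _ => 0
  | lt _ _ => 0
  | eq _ _ => 0
  | neg φ => depth φ
  | and φ ψ => max (depth φ) (depth ψ)
  | or φ ψ => max (depth φ) (depth ψ)
  | ex _ φ => depth φ + 1
  | all _ φ => depth φ + 1

/-- Auxiliary count for `blocks`. The first argument is `true` if the current subformula is under
an even number of negations; a quantifier under an odd number of negations counts as its dual.
The second argument is the innermost (dualized) quantifier above the current subformula, if any:
`some true` for `∃`, `some false` for `∀`. The value is the maximal number of new blocks of equal
quantifiers that a path below opens. -/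
def blocksAux : Bool → Option Bool → Formula A → ℕ
  | _, _, letter _ _ => 0
  | _, _, lt _ _ => 0
  | _, _, eq _ _ => 0
  | p, q, neg φ => blocksAux (!p) q φ
  | p, q, and φ ψ => max (blocksAux p q φ) (blocksAux p q ψ)
  | p, q, or φ ψ => max (blocksAux p q φ) (blocksAux p q ψ)
  | p, q, ex _ φ => (if q = some p then 0 else 1) + blocksAux p (some p) φ
  | p, q, all _ φ => (if q = some (!p) then 0 else 1) + blocksAux p (some (!p)) φ

/-- The maximal number of blocks of alternating quantifiers on a path in the parse tree, where
negations are pushed to the atoms. -/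
def blocks (φ : Formula A) : ℕ := blocksAux true none φ

end Formula

/-- The sentences of `FO²_{m,n}[<]` over the alphabet `A`: quantifier depth at most `n` and at most
`m` blocks of alternating quantifiers on every path. -/
def FO2Depth (A : Type) (m n : ℕ) : Set (Formula A) :=
  {φ | φ.IsSentence ∧ φ.depth ≤ n ∧ φ.blocks ≤ m}

/-- The sentences of `FO²_m[<]` over the alphabet `A`. -/
def FO2Alt (A : Type) (m : ℕ) : Set (Formula A) := ⋃ n ≥ m, FO2Depth A m n

/-- The languages over `A` that are defined by a sentence of `FO²_m[<]`. -/
def Definable (A : Type) (m : ℕ) : Set (Language A) :=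
  {R | ∃ φ ∈ FO2Alt A m, ∀ w : List A, w ∈ R ↔ φ.Models w}

/-- `φ` separates `K` and `L`: it holds on all of `K` and nowhere on `L`, or vice versa. -/
def Separates {A : Type} (φ : Formula A) (K L : Language A) : Prop :=
  ((∀ w ∈ K, φ.Models w) ∧ (∀ w ∈ L, ¬ φ.Models w)) ∨
  ((∀ w ∈ K, ¬ φ.Models w) ∧ (∀ w ∈ L, φ.Models w))

/-- The word `w` repeated `n` times. -/
def rep {A : Type} (n : ℕ) (w : List A) : List A := (List.replicate n w).flatten

/-- The step from the alphabet `{a_0, …, a_{m-1}}` to `{a_0, …, a_m}`: for odd `m + 1`, put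
`(a_0 … a_m)^n` in front of the word, for even `m + 1`, append `(a_m … a_0)^n` to it. -/
def extend (m n : ℕ) (w : List (Fin m)) : List (Fin (m + 1)) :=
  if Odd (m + 1) then rep n (List.finRange (m + 1)) ++ w.map Fin.castSucc
  else w.map Fin.castSucc ++ rep n (List.finRange (m + 1)).reverse

/-- The words `u_{m,n}` over the alphabet `{a_0, …, a_{m-1}}`, for `m ≥ 1` (the value at `m = 0` is
not used). -/
def uWord : (m : ℕ) → ℕ → List (Fin m)
  | 0, _ => []
  | 1, _ => [0]
  | 2, n => 0 :: rep (2 * n) [1, 0]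
  | k + 3, n => extend (k + 2) n (uWord (k + 2) n)

/-- The words `v_{m,n}` over the alphabet `{a_0, …, a_{m-1}}`, for `m ≥ 1` (the value at `m = 0` is
not used). -/
def vWord : (m : ℕ) → ℕ → List (Fin m)
  | 0, _ => []
  | 1, _ => []
  | 2, n => rep (2 * n) [1, 0]
  | k + 3, n => extend (k + 2) n (vWord (k + 2) n)

/-- The language `K_m = {u_{m,n} | n ≥ 1}`. -/
def langK (m : ℕ) : Language (Fin m) := {w | ∃ n ≥ 1, w = uWord m n}

/-- The language `L_m = {v_{m,n} | n ≥ 1}`. -/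
def langL (m : ℕ) : Language (Fin m) := {w | ∃ n ≥ 1, w = vWord m n}

end FO2

/-! The words `u` and `v` with the same indices differ by one occurrence of `a_0`, at a position `c`
of `u`. For the lower bound, both are regarded as `u` in which `c` may be missing, and the
duplicator gets a strategy in the two-pebble game that never answers with `c`. One such strategy
works whichever of the two words the spoiler plays in. It is recorded as a `System` of relations `R
k n` with `k` the number of side changes (new blocks) and `n` the number of rounds left.

The strategy is built along the recursion for the words. In `u_2` the duplicator survives one block
by drifting to the right, keeping the parity. Each further pad contains every letter in each of its
periods, and these periods form a ladder: one rung is used up per round. `System.extend_lower` and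
`System.extend_upper` show that a fresh ladder on one side, combined with the previous ladder on the
other side, buys one more block; this is why the pads alternate between left and right.
`System.transfer` turns the strategy into preservation of formulas.

For the upper bound, the outermost pad is the only part of `u_{j+1}` that contains `a_j`, and it
meets `u_j` in that letter. So one quantifier block per pad suffices to define the factor `u_j`, and
a final block asks whether the innermost factor is nonempty. -/

namespace FO2

/-! ### Duplicator strategies with a missing position, and their extension by a ladder. -/

section System

variable {α B : Type*} [LinearOrder α]

/-- A winning strategy for the duplicator in the two-pebble game in which the position `c` may be
missing on either side. `R k n i i'` relates positions of the interval `I` from which the spoiler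
may still open `k` new blocks and play `n` rounds. -/
structure System (ℓ : α → B) (c : α) (I : Set α) (K N : ℕ) (R : ℕ → ℕ → α → α → Prop) :
    Prop where
  dom : ∀ k n i i', k < K → R k n i i' → i ∈ I ∧ i' ∈ I ∧ ℓ i = ℓ i'
  mono : ∀ k n i i', k < K → n < N → R k (n + 1) i i' → R k n i i'
  flip : ∀ k n i i', k + 1 < K → n ≤ N → R (k + 1) n i i' → R k n i' i
  left : ∀ k n i i', k < K → n < N → R k (n + 1) i i' → ∀ j ∈ I, j < i →
    ∃ j', j' < i' ∧ j' ≠ c ∧ R k n j j'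
  right : ∀ k n i i', k < K → n < N → R k (n + 1) i i' → ∀ j ∈ I, i < j →
    ∃ j', i' < j' ∧ j' ≠ c ∧ R k n j j'
  start : ∀ k n, k < K → n < N → ∀ j ∈ I, ∃ x, x ≠ c ∧ R k n j x

/-- Landmarks `p 0 < p 1 < ⋯ < p N` below `c` such that all letters of `I` occur between
consecutive ones. -/
structure Ladder (ℓ : α → B) (c : α) (I : Set α) (N : ℕ) (R : ℕ → ℕ → α → α → Prop)
    (p : ℕ → α) : Prop where
  le_center : ∀ n ≤ N, p n ≤ c
  step : ∀ n < N, ∀ i ∈ I, ∃ j ∈ I, p n ≤ j ∧ j < p (n + 1) ∧ ℓ j = ℓ i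
  outer : ∀ n ≤ N, ∀ i i', R 0 n i i' → i = i' ∨ p n ≤ i

/-- Landmarks `q N < ⋯ < q 1 < q 0` above `c` such that all letters of `I` occur between
consecutive ones. -/
structure UpperLadder (ℓ : α → B) (c : α) (I : Set α) (N : ℕ) (R : ℕ → ℕ → α → α → Prop)
    (q : ℕ → α) : Prop where
  center_le : ∀ n ≤ N, c ≤ q n
  step : ∀ n < N, ∀ i ∈ I, ∃ j ∈ I, j ≤ q n ∧ q (n + 1) < j ∧ ℓ j = ℓ i
  outer : ∀ n ≤ N, ∀ i i', R 0 n i i' → i = i' ∨ i ≤ q n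

theorem System.dual {ℓ : α → B} {c : α} {I : Set α} {K N : ℕ} {R : ℕ → ℕ → α → α → Prop}
    (h : System ℓ c I K N R) : System (α := αᵒᵈ) ℓ c I K N R where
  dom := h.dom
  mono := h.mono
  flip := h.flip
  left := h.right
  right := h.left
  start := h.start

theorem System.of_dual {ℓ : α → B} {c : α} {I : Set α} {K N : ℕ} {R : ℕ → ℕ → α → α → Prop}
    (h : System (α := αᵒᵈ) ℓ c I K N R) : System ℓ c I K N R where
  dom := h.dom
  mono := h.mono
  flip := h.flip
  left := h.right
  right := h.left
  start := h.start

/-- The relations on `I` obtained from relations `R` on a final segment `J` of `I`. -/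
def extRel (ℓ : α → B) (I J : Set α) (p q : ℕ → α) (R : ℕ → ℕ → α → α → Prop) :
    ℕ → ℕ → α → α → Prop
  | 0, n, i, i' => i ∈ I ∧ i' ∈ I ∧ ℓ i = ℓ i' ∧
      (i = i' ∨ (p n ≤ i ∧ p n ≤ i' ∧ i' ≤ i) ∨ (i ∈ J ∧ i' ∈ J ∧ i' ≤ q n))
  | k + 1, n, i, i' => R k n i i' ∨ (i = i' ∧ i ∈ I ∧ i ∉ J)

/-- The old levels move up by one, with the new prefix matched identically, and a new level 0 is put
underneath. At level 0 the spoiler can no longer change sides, so a one-sided invariant suffices: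
equal positions, or `i' ≤ i` with both beyond `p n`, or both in `J` with `i' ≤ q n`. Moves to the
left find a substitute in a rung of `p`; moves to the right are copied or find one in a rung of `q`.
The last clause is what a flip out of the old level 0 produces, by `UpperLadder.outer`. -/
theorem System.extend_lower {ℓ : α → B} {c : α} {I J : Set α} {K N : ℕ}
    {R : ℕ → ℕ → α → α → Prop} {p q : ℕ → α} (h : System ℓ c J K N R) (hK : 0 < K)
    (hq : UpperLadder ℓ c J N R q) (hc : c ∈ J) (hJI : J ⊆ I)
    (hup : ∀ x ∈ J, ∀ y ∈ I, x ≤ y → y ∈ J)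
    (hp : ∀ n ≤ N, ∀ x ∈ J, p n ≤ x)
    (hstep : ∀ n < N, ∀ i ∈ I, ∃ j ∈ I, p n ≤ j ∧ j < p (n + 1) ∧ ℓ j = ℓ i) :
    ∃ R', System ℓ c I (K + 1) N R' ∧ Ladder ℓ c I N R' p := by
  obtain ⟨hq1, hq2, hq3⟩ := hq
  have hpm : ∀ n < N, p n ≤ p (n + 1) := fun n hn => by
    obtain ⟨j, -, h1, h2, -⟩ := hstep n hn c (hJI hc)
    exact h1.trans h2.le
  have hqm : ∀ n < N, q (n + 1) ≤ q n := fun n hn => by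
    obtain ⟨j, -, h1, h2, -⟩ := hq2 n hn c hc
    exact h2.le.trans h1
  -- answering the missing position on either side
  have cright : ∀ n < N, ∃ j', c < j' ∧ extRel ℓ I J p q R 0 n c j' := fun n hn => by
    obtain ⟨j, hj, h1, h2, h3⟩ := hq2 n hn c hc
    exact ⟨j, (hq1 (n + 1) hn).trans_lt h2, hJI hc, hJI hj, h3.symm, Or.inr (Or.inr ⟨hc, hj, h1⟩)⟩
  have cleft : ∀ n < N, ∃ j', j' < c ∧ extRel ℓ I J p q R 0 n c j' := fun n hn => by
    obtain ⟨j, hj, h1, h2, h3⟩ := hstep n hn c (hJI hc)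
    have hlt : j < c := h2.trans_le (hp (n + 1) hn c hc)
    exact ⟨j, hlt, hJI hc, hj, h3.symm, Or.inr (Or.inl ⟨hp n hn.le c hc, h1, hlt.le⟩)⟩
  have idrel : ∀ n j, j ∈ I → extRel ℓ I J p q R 0 n j j := fun n j hj =>
    ⟨hj, hj, rfl, Or.inl rfl⟩
  have low : ∀ x ∈ I, x ∉ J → ∀ y ∈ J, x < y := fun x hx hxJ y hy =>
    lt_of_not_ge fun hle => hxJ (hup y hy x hx hle)
  refine ⟨extRel ℓ I J p q R, ⟨?_, ?_, ?_, ?_, ?_, ?_⟩, ⟨?_, hstep, ?_⟩⟩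
  · rintro (_ | k) n i i' hk hr
    · exact ⟨hr.1, hr.2.1, hr.2.2.1⟩
    · rcases hr with hr | ⟨rfl, hi, -⟩
      · obtain ⟨h1, h2, h3⟩ := h.dom k n i i' (by omega) hr
        exact ⟨hJI h1, hJI h2, h3⟩
      · exact ⟨hi, hi, rfl⟩
  · rintro (_ | k) n i i' hk hn hr
    · obtain ⟨h1, h2, h3, rfl | ⟨h4, h5, h6⟩ | ⟨h4, h5, h6⟩⟩ := hr
      · exact idrel n i h1
      · exact ⟨h1, h2, h3, Or.inr (Or.inl ⟨(hpm n hn).trans h4, (hpm n hn).trans h5, h6⟩)⟩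
      · exact ⟨h1, h2, h3, Or.inr (Or.inr ⟨h4, h5, h6.trans (hqm n hn)⟩)⟩
    · exact hr.imp_left (h.mono k n i i' (by omega) hn)
  · rintro (_ | k) n i i' hk hn hr
    · rcases hr with hr | ⟨rfl, hi, -⟩
      · obtain ⟨h1, h2, h3⟩ := h.dom 0 n i i' (by omega) hr
        refine ⟨hJI h2, hJI h1, h3.symm, ?_⟩
        rcases hq3 n hn i i' hr with rfl | h4
        · exact Or.inl rfl
        · exact Or.inr (Or.inr ⟨h2, h1, h4⟩)
      · exact idrel n i hi
    · rcases hr with hr | ⟨rfl, hi, hiJ⟩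
      · exact Or.inl (h.flip k n i i' (by omega) hn hr)
      · exact Or.inr ⟨rfl, hi, hiJ⟩
  · rintro (_ | k) n i i' hk hn hr j hj hji
    -- A move below `p (n + 1)` is copied exactly; any other goes to the same letter in the rung
    -- between `p n` and `p (n + 1)`.
    · have key : p (n + 1) ≤ i → p (n + 1) ≤ i' →
          ∃ j', j' < i' ∧ j' ≠ c ∧ extRel ℓ I J p q R 0 n j j' := fun h1 h2 => by
        by_cases hlt : j < p (n + 1)
        · exact ⟨j, hlt.trans_le h2, (hlt.trans_le (hp (n + 1) hn c hc)).ne, idrel n j hj⟩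
        · obtain ⟨j', hj', h3, h4, h5⟩ := hstep n hn j hj
          have hle := not_lt.1 hlt
          exact ⟨j', h4.trans_le h2, (h4.trans_le (hp (n + 1) hn c hc)).ne, hj, hj', h5.symm,
            Or.inr (Or.inl ⟨(hpm n hn).trans hle, h3, h4.le.trans hle⟩)⟩
      obtain ⟨h1, h2, h3, rfl | ⟨h4, h5, h6⟩ | ⟨h4, h5, h6⟩⟩ := hr
      · by_cases hjc : j = c
        · subst hjc
          obtain ⟨j', h4, h5⟩ := cleft n hn
          exact ⟨j', h4.trans hji, h4.ne, h5⟩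
        · exact ⟨j, hji, hjc, idrel n j hj⟩
      · exact key h4 h5
      · exact key (hp _ hn _ h4) (hp _ hn _ h5)
    · rcases hr with hr | ⟨rfl, hi, hiJ⟩
      · obtain ⟨h1, h2, -⟩ := h.dom k (n + 1) i i' (by omega) hr
        by_cases hjJ : j ∈ J
        · obtain ⟨j', h3, h4, h5⟩ := h.left k n i i' (by omega) hn hr j hjJ hji
          exact ⟨j', h3, h4, Or.inl h5⟩
        · exact ⟨j, low j hj hjJ _ h2, (low j hj hjJ c hc).ne, Or.inr ⟨rfl, hj, hjJ⟩⟩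
      · have hjJ : j ∉ J := fun hjJ => hiJ (hup j hjJ i hi hji.le)
        exact ⟨j, hji, (low j hj hjJ c hc).ne, Or.inr ⟨rfl, hj, hjJ⟩⟩
  · rintro (_ | k) n i i' hk hn hr j hj hij
    · have key : i' < c → j = c → ∃ j', i' < j' ∧ j' ≠ c ∧ extRel ℓ I J p q R 0 n j j' := by
        rintro h1 rfl
        obtain ⟨j', h4, h5⟩ := cright n hn
        exact ⟨j', h1.trans h4, h4.ne', h5⟩
      obtain ⟨h1, h2, h3, rfl | ⟨h4, h5, h6⟩ | ⟨h4, h5, h6⟩⟩ := hr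
      · by_cases hjc : j = c
        · exact key (hjc ▸ hij) hjc
        · exact ⟨j, hij, hjc, idrel n j hj⟩
      · by_cases hjc : j = c
        · exact key (h6.trans_lt (hjc ▸ hij)) hjc
        · exact ⟨j, h6.trans_lt hij, hjc, idrel n j hj⟩
      · have hjJ : j ∈ J := hup i h4 j hj hij.le
        -- If `j` cannot be copied, its letter is found in the rung between `q (n + 1)` and `q n`,
        -- which lies beyond both `i'` and `c`.
        by_cases hlt : i' < j ∧ j ≠ c
        · exact ⟨j, hlt.1, hlt.2, idrel n j hj⟩
        · obtain ⟨j', hj', h7, h8, h9⟩ := hq2 n hn j hjJ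
          exact ⟨j', h6.trans_lt h8, ((hq1 (n + 1) hn).trans_lt h8).ne', hj, hJI hj', h9.symm,
            Or.inr (Or.inr ⟨hjJ, hj', h7⟩)⟩
    · rcases hr with hr | ⟨rfl, hi, hiJ⟩
      · obtain ⟨h1, h2, -⟩ := h.dom k (n + 1) i i' (by omega) hr
        obtain ⟨j', h3, h4, h5⟩ :=
          h.right k n i i' (by omega) hn hr j (hup i h1 j hj hij.le) hij
        exact ⟨j', h3, h4, Or.inl h5⟩
      -- A pebble in the identical prefix imposes no constraint on an answer inside `J`, so `start`
      -- applies there.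
      · by_cases hjJ : j ∈ J
        · obtain ⟨j', h4, h5⟩ := h.start k n (by omega) hn j hjJ
          exact ⟨j', low i hi hiJ j' (h.dom k n j j' (by omega) h5).2.1, h4, Or.inl h5⟩
        · exact ⟨j, hij, (low j hj hjJ c hc).ne, Or.inr ⟨rfl, hj, hjJ⟩⟩
  · rintro (_ | k) n hk hn j hj
    · by_cases hjc : j = c
      · subst hjc
        obtain ⟨j', h4, h5⟩ := cleft n hn
        exact ⟨j', h4.ne, h5⟩
      · exact ⟨j, hjc, idrel n j hj⟩
    · by_cases hjJ : j ∈ J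
      · obtain ⟨j', h4, h5⟩ := h.start k n (by omega) hn j hjJ
        exact ⟨j', h4, Or.inl h5⟩
      · exact ⟨j, (low j hj hjJ c hc).ne, Or.inr ⟨rfl, hj, hjJ⟩⟩
  · exact fun n hn => hp n hn c hc
  · rintro n hn i i' ⟨h1, h2, h3, h4 | ⟨h4, h5, h6⟩ | ⟨h4, h5, h6⟩⟩
    · exact Or.inl h4
    · exact Or.inr h4
    · exact Or.inr (hp n hn i h4)

theorem System.extend_upper {ℓ : α → B} {c : α} {I J : Set α} {K N : ℕ}
    {R : ℕ → ℕ → α → α → Prop} {p q : ℕ → α} (h : System ℓ c J K N R) (hK : 0 < K)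
    (hp : Ladder ℓ c J N R p) (hc : c ∈ J) (hJI : J ⊆ I)
    (hdown : ∀ x ∈ J, ∀ y ∈ I, y ≤ x → y ∈ J) (hq : ∀ n ≤ N, ∀ x ∈ J, x ≤ q n)
    (hstep : ∀ n < N, ∀ i ∈ I, ∃ j ∈ I, j ≤ q n ∧ q (n + 1) < j ∧ ℓ j = ℓ i) :
    ∃ R', System ℓ c I (K + 1) N R' ∧ UpperLadder ℓ c I N R' q := by
  have hp' : UpperLadder (α := αᵒᵈ) ℓ c J N R p := ⟨hp.le_center, hp.step, hp.outer⟩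
  obtain ⟨R', h1, h2⟩ := System.extend_lower (α := αᵒᵈ) h.dual hK hp' hc hJI hdown hq hstep
  exact ⟨R', h1.of_dual, h2.le_center, h2.step, h2.outer⟩

end System

/-- The relation for the alternating word `0 (1 0)^(2N)` that starts at position `t`. -/
def baseRel (t N : ℕ) (_k n i i' : ℕ) : Prop :=
  t ≤ i ∧ i ≤ i' ∧ i' ≤ t + 4 * N ∧ (i - t) % 2 = (i' - t) % 2 ∧ t + 1 + 2 * n ≤ i' ∧
    (i = i' ∨ i' + 2 * n ≤ t + 4 * N)

/-- The answer is never left of the spoiler's pebble, and keeps distance `2 * n + 1` from the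
missing left end. It keeps distance `2 * n` from the right end unless the two pebbles coincide. Two
adjacent positions show both letters, so each round costs at most 2 on either side. -/
theorem system_base {B : Type*} {ℓ : ℕ → B} {t N : ℕ}
    (hℓ : ∀ i j, t ≤ i → i ≤ t + 4 * N → t ≤ j → j ≤ t + 4 * N → (i - t) % 2 = (j - t) % 2 →
      ℓ i = ℓ j) :
    System ℓ t (Set.Ico t (t + (4 * N + 1))) 1 N (baseRel t N) ∧
      UpperLadder ℓ t (Set.Ico t (t + (4 * N + 1))) N (baseRel t N)
        (fun n => t + 4 * N - 2 * n) := by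
  refine ⟨⟨?_, ?_, ?_, ?_, ?_, ?_⟩, ⟨?_, ?_, ?_⟩⟩
  · rintro k n i i' hk ⟨h1, h2, h3, h4, h5, h6⟩
    exact ⟨⟨h1, by omega⟩, ⟨by omega, by omega⟩, hℓ _ _ h1 (by omega) (by omega) h3 h4⟩
  · rintro k n i i' hk hn ⟨h1, h2, h3, h4, h5, h6⟩
    exact ⟨h1, h2, h3, h4, by omega, by omega⟩
  · omega
  · rintro k n i i' hk hn ⟨h1, h2, h3, h4, h5, h6⟩ j ⟨hj1, hj2⟩ hji
    by_cases hlt : t + 1 + 2 * n ≤ j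
    · exact ⟨j, by omega, by omega, by unfold baseRel; omega⟩
    -- The first admissible position with the parity of `j`.
    · exact ⟨t + 1 + 2 * n + (j + 1 - t) % 2, by omega, by omega, by unfold baseRel; omega⟩
  · rintro k n i i' hk hn ⟨h1, h2, h3, h4, h5, h6⟩ j ⟨hj1, hj2⟩ hij
    by_cases hlt : i' < j
    · exact ⟨j, by omega, by omega, by unfold baseRel; omega⟩
    -- The first position after `i'` with the parity of `j`. There is room because `i < j ≤ i'`
    -- excludes `i = i'`.
    · exact ⟨i' + 1 + (i' + 1 + j) % 2, by omega, by omega, by unfold baseRel; omega⟩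
  · rintro k n hk hn j ⟨hj1, hj2⟩
    by_cases hlt : t + 1 + 2 * n ≤ j
    · exact ⟨j, by omega, by unfold baseRel; omega⟩
    · exact ⟨t + 1 + 2 * n + (j + 1 - t) % 2, by omega, by unfold baseRel; omega⟩
  · intro n hn
    omega
  · rintro n hn i ⟨hi1, hi2⟩
    refine ⟨t + 4 * N - 2 * n - (i - t) % 2, ⟨by omega, by omega⟩, by omega, by omega,
      hℓ _ _ (by omega) (by omega) (by omega) (by omega) (by omega)⟩
  · rintro n hn i i' ⟨h1, h2, h3, h4, h5, h6⟩
    omega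

/-! ### The strategies on the words `u_{m,n}`. -/

section Words

variable {A : Type}

theorem length_rep (n : ℕ) (w : List A) : (rep n w).length = n * w.length := by
  simp [rep]

theorem rep_add (a b : ℕ) (w : List A) : rep (a + b) w = rep a w ++ rep b w := by
  rw [rep, rep, rep, ← List.replicate_append_replicate, List.flatten_append]

theorem rep_succ (n : ℕ) (w : List A) : rep (n + 1) w = w ++ rep n w := by
  simp [rep, List.replicate_succ]

theorem rep_succ' (n : ℕ) (w : List A) : rep (n + 1) w = rep n w ++ w := by
  rw [rep_add]
  simp [rep]

theorem mem_of_mem_rep {n : ℕ} {w : List A} {a : A} (h : a ∈ rep n w) : a ∈ w := by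
  simp only [rep, List.mem_flatten, List.mem_replicate] at h
  obtain ⟨l, ⟨-, rfl⟩, h⟩ := h
  exact h

theorem map_rep {B : Type} (f : A → B) (n : ℕ) (w : List A) :
    (rep n w).map f = rep n (w.map f) := by
  simp [rep, List.map_flatten]

theorem exists_getElem?_rep (P S : List A) {W : List A} {n N : ℕ} (hn : n < N) {b : A}
    (hb : b ∈ W) :
    ∃ j, P.length + n * W.length ≤ j ∧ j < P.length + (n + 1) * W.length ∧
      (P ++ rep N W ++ S)[j]? = some b := by
  obtain ⟨W₁, W₂, rfl⟩ := List.append_of_mem hb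
  obtain ⟨d, rfl⟩ : ∃ d, N = n + 1 + d := ⟨N - (n + 1), by omega⟩
  refine ⟨(P ++ rep n (W₁ ++ b :: W₂) ++ W₁).length, ?_, ?_, ?_⟩
  · simp [length_rep]
  · simp only [List.length_append, length_rep, List.length_cons, add_mul]
    omega
  · have : P ++ rep (n + 1 + d) (W₁ ++ b :: W₂) ++ S =
        (P ++ rep n (W₁ ++ b :: W₂) ++ W₁) ++ b :: (W₂ ++ rep d (W₁ ++ b :: W₂) ++ S) := by
      rw [rep_add, rep_succ']
      simp
    rw [this, List.getElem?_append_right le_rfl]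
    simp

theorem exists_mem_getElem? (P Z S : List A) {i : ℕ} (h1 : P.length ≤ i)
    (h2 : i < P.length + Z.length) : ∃ b ∈ Z, (P ++ Z ++ S)[i]? = some b := by
  refine ⟨Z[i - P.length], List.getElem_mem _, ?_⟩
  rw [List.append_assoc, List.getElem?_append_right h1, List.getElem?_append_left (by omega)]
  exact List.getElem?_eq_getElem _

/-- In every context, the word `X 0 Y` carries a system of relations with a ladder on the left. -/
def LeftSystem (X Y : List ℕ) (K N : ℕ) : Prop :=
  ∀ P S : List ℕ, ∃ R p,
    System (fun i => (P ++ (X ++ 0 :: Y) ++ S)[i]?) (P.length + X.length)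
      (Set.Ico P.length (P.length + (X ++ 0 :: Y).length)) K N R ∧
    Ladder (fun i => (P ++ (X ++ 0 :: Y) ++ S)[i]?) (P.length + X.length)
      (Set.Ico P.length (P.length + (X ++ 0 :: Y).length)) N R p

/-- In every context, the word `X 0 Y` carries a system of relations with a ladder on the right. -/
def RightSystem (X Y : List ℕ) (K N : ℕ) : Prop :=
  ∀ P S : List ℕ, ∃ R q,
    System (fun i => (P ++ (X ++ 0 :: Y) ++ S)[i]?) (P.length + X.length)
      (Set.Ico P.length (P.length + (X ++ 0 :: Y).length)) K N R ∧
    UpperLadder (fun i => (P ++ (X ++ 0 :: Y) ++ S)[i]?) (P.length + X.length)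
      (Set.Ico P.length (P.length + (X ++ 0 :: Y).length)) N R q

/-- The `N` copies of `W` are the rungs: `p n` is the start of copy `n`, counted from 0, and `p N`
is the start of the old word. -/
theorem RightSystem.pad_left {X Y : List ℕ} {K N : ℕ} (h : RightSystem X Y K N) (hK : 0 < K)
    {W : List ℕ} (hW : ∀ b ∈ X ++ 0 :: Y, b ∈ W) :
    LeftSystem (rep N W ++ X) Y (K + 1) N := by
  intro P S
  obtain ⟨R, q, hs, hq⟩ := h (P ++ rep N W) S
  have hcN : (P ++ rep N W).length = P.length + N * W.length := by simp [length_rep]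
  have hl : (X ++ 0 :: Y).length = X.length + (Y.length + 1) := by simp
  have hl' : (rep N W ++ X ++ 0 :: Y).length = N * W.length + (X.length + (Y.length + 1)) := by
    simp [length_rep]
  have hc : P.length + (rep N W ++ X).length = (P ++ rep N W).length + X.length := by simp; ring
  have hw : P ++ (rep N W ++ X ++ 0 :: Y) ++ S = P ++ rep N W ++ (X ++ 0 :: Y) ++ S := by simp
  have hw' : P ++ rep N W ++ (X ++ 0 :: Y) ++ S = P ++ rep N W ++ ((X ++ 0 :: Y) ++ S) := by simp
  rw [hcN, hl] at hs hq
  rw [hc, hcN, hl', hw]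
  have hstep : ∀ n < N,
      ∀ i ∈ Set.Ico P.length (P.length + (N * W.length + (X.length + (Y.length + 1)))),
      ∃ j ∈ Set.Ico P.length (P.length + (N * W.length + (X.length + (Y.length + 1)))),
        P.length + n * W.length ≤ j ∧ j < P.length + (n + 1) * W.length ∧
        (P ++ rep N W ++ (X ++ 0 :: Y) ++ S)[j]? = (P ++ rep N W ++ (X ++ 0 :: Y) ++ S)[i]? := by
    intro n hn i hi
    have hle : (n + 1) * W.length ≤ N * W.length := Nat.mul_le_mul_right _ hn
    obtain ⟨b, hb, hib⟩ := exists_mem_getElem? P (rep N W ++ X ++ 0 :: Y) S hi.1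
      (by rw [hl']; exact hi.2)
    have hbW : b ∈ W := by
      rw [List.append_assoc, List.mem_append] at hb
      exact hb.elim mem_of_mem_rep (hW b)
    obtain ⟨j, h1, h2, h3⟩ := exists_getElem?_rep P ((X ++ 0 :: Y) ++ S) hn hbW
    exact ⟨j, ⟨by omega, by omega⟩, h1, h2, by rw [hw', h3, ← hw', ← hw, hib]⟩
  obtain ⟨Q, hQ⟩ := hs.extend_lower
    (I := Set.Ico P.length (P.length + (N * W.length + (X.length + (Y.length + 1)))))
    (p := fun n => P.length + n * W.length) hK hq
    ⟨by omega, by omega⟩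
    (fun x hx => ⟨by have := hx.1; omega, by have := hx.2; omega⟩)
    (fun x hx y hy hxy => ⟨hx.1.trans hxy, by have := hy.2; omega⟩)
    (fun n hn x hx => le_trans (by gcongr) hx.1) hstep
  exact ⟨Q, _, hQ⟩

theorem LeftSystem.pad_right {X Y : List ℕ} {K N : ℕ} (h : LeftSystem X Y K N) (hK : 0 < K)
    {W : List ℕ} (hW : ∀ b ∈ X ++ 0 :: Y, b ∈ W) :
    RightSystem X (Y ++ rep N W) (K + 1) N := by
  intro P S
  obtain ⟨R, p, hs, hp⟩ := h P (rep N W ++ S)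
  have hl : (X ++ 0 :: Y).length = X.length + (Y.length + 1) := by simp
  have hl' : (X ++ 0 :: (Y ++ rep N W)).length = X.length + (Y.length + 1) + N * W.length := by
    simp [length_rep]; ring
  have hw : P ++ (X ++ 0 :: (Y ++ rep N W)) ++ S = P ++ (X ++ 0 :: Y) ++ (rep N W ++ S) := by simp
  have hw' : P ++ (X ++ 0 :: Y) ++ (rep N W ++ S) = (P ++ (X ++ 0 :: Y)) ++ rep N W ++ S := by simp
  rw [hl] at hs hp
  rw [hl', hw]
  have hstep : ∀ n < N,
      ∀ i ∈ Set.Ico P.length (P.length + (X.length + (Y.length + 1) + N * W.length)),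
      ∃ j ∈ Set.Ico P.length (P.length + (X.length + (Y.length + 1) + N * W.length)),
        j ≤ P.length + X.length + Y.length + (N - n) * W.length ∧
        P.length + X.length + Y.length + (N - (n + 1)) * W.length < j ∧
        (P ++ (X ++ 0 :: Y) ++ (rep N W ++ S))[j]? =
          (P ++ (X ++ 0 :: Y) ++ (rep N W ++ S))[i]? := by
    intro n hn i hi
    obtain ⟨d, rfl⟩ : ∃ d, N = n + 1 + d := ⟨N - (n + 1), by omega⟩
    have hle : (d + 1) * W.length ≤ (n + 1 + d) * W.length := Nat.mul_le_mul_right _ (by omega)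
    obtain ⟨b, hb, hib⟩ := exists_mem_getElem? P (X ++ 0 :: (Y ++ rep (n + 1 + d) W)) S hi.1
      (by rw [hl']; exact hi.2)
    have hbW : b ∈ W := by
      rw [← List.cons_append, ← List.append_assoc, List.mem_append] at hb
      exact hb.elim (hW b) mem_of_mem_rep
    obtain ⟨j, h1, h2, h3⟩ := exists_getElem?_rep (P ++ (X ++ 0 :: Y)) S
      (show d < n + 1 + d by omega) hbW
    rw [List.length_append, hl] at h1 h2
    have e1 : n + 1 + d - n = d + 1 := by omega
    have e2 : n + 1 + d - (n + 1) = d := by omega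
    refine ⟨j, ⟨by omega, by omega⟩, ?_, ?_, ?_⟩
    · rw [e1]; omega
    · rw [e2]; omega
    · rw [hw', h3, ← hw', ← hw, hib]
  obtain ⟨Q, hQ⟩ := hs.extend_upper
    (I := Set.Ico P.length (P.length + (X.length + (Y.length + 1) + N * W.length)))
    -- The last position of the first `N - n` copies; for `n = N` it is the last position of the old
    -- word.
    (q := fun n => P.length + X.length + Y.length + (N - n) * W.length) hK hp
    ⟨by omega, by omega⟩
    (fun x hx => ⟨hx.1, by have := hx.2; omega⟩)
    (fun x hx y hy hxy => ⟨hy.1, hxy.trans_lt hx.2⟩)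
    (fun n hn x hx => by have := hx.2; omega) hstep
  exact ⟨Q, _, hQ⟩

/-- The words `u_{m,n}` with letters written as natural numbers. -/
def uNat (m n : ℕ) : List ℕ := (uWord m n).map Fin.val

/-- The words `v_{m,n}` with letters written as natural numbers. -/
def vNat (m n : ℕ) : List ℕ := (vWord m n).map Fin.val

theorem map_val_extend (m n : ℕ) (w : List (Fin m)) :
    (extend m n w).map Fin.val =
      if Odd (m + 1) then rep n (List.range (m + 1)) ++ w.map Fin.val
      else w.map Fin.val ++ rep n (List.range (m + 1)).reverse := by
  have h : (List.finRange (m + 1)).map Fin.val = List.range (m + 1) :=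
    List.map_coe_finRange_eq_range
  have hw : (w.map Fin.castSucc).map Fin.val = w.map Fin.val := by simp
  unfold extend
  split_ifs
  · rw [List.map_append, map_rep, h, hw]
  · rw [List.map_append, map_rep, List.map_reverse, h, hw]

theorem uNat_succ (k n : ℕ) : uNat (k + 3) n =
    if Odd (k + 3) then rep n (List.range (k + 3)) ++ uNat (k + 2) n
    else uNat (k + 2) n ++ rep n (List.range (k + 3)).reverse :=
  map_val_extend (k + 2) n (uWord (k + 2) n)

theorem vNat_succ (k n : ℕ) : vNat (k + 3) n =
    if Odd (k + 3) then rep n (List.range (k + 3)) ++ vNat (k + 2) n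
    else vNat (k + 2) n ++ rep n (List.range (k + 3)).reverse :=
  map_val_extend (k + 2) n (vWord (k + 2) n)

theorem uNat_two (n : ℕ) : uNat 2 n = 0 :: rep (2 * n) [1, 0] := by
  simp [uNat, uWord, map_rep]

theorem vNat_two (n : ℕ) : vNat 2 n = rep (2 * n) [1, 0] := by
  simp [vNat, vWord, map_rep]

theorem lt_of_mem_uNat {m n b : ℕ} (h : b ∈ uNat m n) : b < m := by
  simp only [uNat, List.mem_map] at h
  obtain ⟨a, -, rfl⟩ := h
  exact a.2

theorem lt_of_mem_vNat {m n b : ℕ} (h : b ∈ vNat m n) : b < m := by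
  simp only [vNat, List.mem_map] at h
  obtain ⟨a, -, rfl⟩ := h
  exact a.2

theorem getElem?_rep_one_zero (n i : ℕ) (hi : i < 2 * n + 1) :
    (0 :: rep n [1, 0] : List ℕ)[i]? = some (i % 2) := by
  induction n generalizing i with
  | zero => obtain rfl : i = 0 := by omega
            rfl
  | succ n ih =>
    match i, hi with
    | 0, _ => rfl
    | 1, _ => rfl
    | i + 2, hi =>
      have := ih i (by omega)
      rw [rep_succ]
      simpa using this

theorem rightSystem_base (N : ℕ) : RightSystem [] (rep (2 * N) [1, 0]) 1 N := by
  intro P S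
  have hl : ([] ++ 0 :: rep (2 * N) [1, 0] : List ℕ).length = 4 * N + 1 := by
    simp [length_rep]; ring
  rw [hl]
  refine ⟨_, _, system_base (t := P.length) fun i j h1 h2 h3 h4 h5 => ?_⟩
  have key : ∀ i, P.length ≤ i → i ≤ P.length + 4 * N →
      (P ++ ([] ++ 0 :: rep (2 * N) [1, 0]) ++ S)[i]? = some ((i - P.length) % 2) := by
    intro i h1 h2
    rw [List.append_assoc, List.getElem?_append_right h1, List.getElem?_append_left (by omega),
      List.nil_append, getElem?_rep_one_zero _ _ (by omega)]
  simp only [key i h1 h2, key j h3 h4, h5]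

/-- The ladder lies on the side of the most recent pad, opposite to where the next pad goes. For
`u_2` it is the alternating word itself. -/
theorem exists_system (m N : ℕ) : ∃ X Y,
    uNat (m + 2) N = X ++ 0 :: Y ∧ vNat (m + 2) N = X ++ Y ∧
      if Odd m then LeftSystem X Y (m + 1) N else RightSystem X Y (m + 1) N := by
  induction m with
  | zero =>
    exact ⟨[], rep (2 * N) [1, 0], uNat_two N, vNat_two N, by simpa using rightSystem_base N⟩
  | succ m ih =>
    obtain ⟨X, Y, hu, hv, h⟩ := ih
    have hlt : ∀ b ∈ X ++ 0 :: Y, b < m + 3 := fun b hb => by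
      rw [← hu] at hb
      have := lt_of_mem_uNat hb
      omega
    rw [show m + 1 + 2 = m + 3 from rfl, uNat_succ, vNat_succ, hu, hv]
    by_cases hm : Odd m
    · have h1 : ¬ Odd (m + 1) := by grind
      have h3 : ¬ Odd (m + 3) := by grind
      simp only [h1, h3, if_false, if_pos hm] at h ⊢
      exact ⟨X, Y ++ rep N (List.range (m + 3)).reverse, by simp, by simp,
        h.pad_right (by omega) (by simpa using hlt)⟩
    · have h1 : Odd (m + 1) := by grind
      have h3 : Odd (m + 3) := by grind
      simp only [h1, h3, if_true, if_neg hm] at h ⊢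
      exact ⟨rep N (List.range (m + 3)) ++ X, Y, by simp, by simp,
        h.pad_left (by omega) (by simpa using hlt)⟩

/-- The words `u_{m,N}` and `v_{m,N}` differ by one letter, whose absence is hidden by a system of
relations with `m - 1` levels. -/
theorem exists_system_uNat (m N : ℕ) : ∃ X Y R,
    uNat (m + 1) N = X ++ 0 :: Y ∧ vNat (m + 1) N = X ++ Y ∧
      System (fun i => (uNat (m + 1) N)[i]?) X.length (Set.Iio (uNat (m + 1) N).length) m N R := by
  cases m with
  -- With no block available every condition is vacuous.
  | zero => exact ⟨[], [], fun _ _ _ _ => False, rfl, rfl, by constructor <;> omega⟩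
  | succ m =>
    obtain ⟨X, Y, hu, hv, h⟩ := exists_system m N
    have : ∃ R, System (fun i => (X ++ 0 :: Y)[i]?) X.length (Set.Iio (X ++ 0 :: Y).length)
        (m + 1) N R := by
      split_ifs at h
      · obtain ⟨R, p, h, -⟩ := h [] []
        refine ⟨R, ?_⟩
        simpa [Set.Iio, Set.Ico] using h
      · obtain ⟨R, p, h, -⟩ := h [] []
        refine ⟨R, ?_⟩
        simpa [Set.Iio, Set.Ico] using h
    obtain ⟨R, hR⟩ := this
    exact ⟨X, Y, R, hu, hv, by rw [hu]; exact hR⟩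

end Words

namespace Formula

variable {A : Type}

/-- Dualizing all quantifiers, including the one above, moves no block boundary. -/
theorem blocksAux_dual (φ : Formula A) (p : Bool) (q : Option Bool) :
    blocksAux (!p) (q.map not) φ = blocksAux p q φ := by
  induction φ generalizing p q with
  | letter | lt | eq => rfl
  | neg φ ih => exact ih (!p) q
  | and φ ψ ih₁ ih₂ | or φ ψ ih₁ ih₂ => simp only [blocksAux, ih₁, ih₂]
  | ex v φ ih =>
    have := ih p (some p)
    simp only [Option.map_some] at this
    simp only [blocksAux, this]
    congr 1
    rcases q with _ | q <;> cases p <;> try cases q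
    all_goals simp
  | all v φ ih =>
    have := ih p (some (!p))
    simp only [Option.map_some] at this
    simp only [blocksAux, this]
    congr 1
    rcases q with _ | q <;> cases p <;> try cases q
    all_goals simp

end Formula

/-! ### From strategies to preservation of formulas. -/

section Transfer

variable {A : Type}

/-- `e` identifies the positions of `w` with those of `u`, where the position `c` may be missing. -/
structure Embeds (u : List A) (c : ℕ) (w : List A) (e : ℕ → ℕ) : Prop where
  strictMono : StrictMono e
  letter : ∀ i, w[i]? = u[e i]?
  lt_length : ∀ i < w.length, e i < u.length
  surj : ∀ j < u.length, j ≠ c → ∃ i < w.length, e i = j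

theorem Embeds.lt_of_lt {u w : List A} {c : ℕ} {e : ℕ → ℕ} (h : Embeds u c w e) {i : ℕ}
    (hi : e i < u.length) : i < w.length := by
  have := h.letter i
  rw [List.getElem?_eq_getElem hi] at this
  exact (List.getElem?_eq_some_iff.1 this).1

theorem embeds_id (u : List A) (c : ℕ) : Embeds u c u id :=
  ⟨strictMono_id, fun _ => rfl, fun _ h => h, fun j h _ => ⟨j, h, rfl⟩⟩

theorem embeds_skip (X Y : List A) (a : A) :
    Embeds (X ++ a :: Y) X.length (X ++ Y) (fun i => if i < X.length then i else i + 1) := by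
  refine ⟨?_, ?_, ?_, ?_⟩
  · intro i j hij
    dsimp only
    split_ifs <;> omega
  · intro i
    split_ifs with h
    · rw [List.getElem?_append_left h, List.getElem?_append_left h]
    · rw [List.getElem?_append_right (by omega), List.getElem?_append_right (by omega),
        Nat.sub_add_comm (by omega), List.getElem?_cons_succ]
  · intro i hi
    simp only [List.length_append, List.length_cons] at hi ⊢
    split_ifs <;> omega
  · intro j hj hjc
    simp only [List.length_append, List.length_cons] at hj ⊢
    by_cases h : j < X.length
    · exact ⟨j, by omega, if_pos h⟩
    · exact ⟨j - 1, by omega, by rw [if_neg (by omega)]; omega⟩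

/-- The assignments `s` and `s'` agree on the variables in `F` up to the relation `r`. -/
structure Related (e e' : ℕ → ℕ) (r : ℕ → ℕ → Prop) (F : Finset (Fin 2)) (s s' : Fin 2 → ℕ) :
    Prop where
  rel : ∀ v ∈ F, r (e (s v)) (e' (s' v))
  lt_iff : ∀ v ∈ F, ∀ v' ∈ F, s v < s v' ↔ s' v < s' v'

theorem Related.mono {e e' : ℕ → ℕ} {r r' : ℕ → ℕ → Prop} {F F' : Finset (Fin 2)}
    {s s' : Fin 2 → ℕ} (h : Related e e' r F s s') (hF : F' ⊆ F)
    (hr : ∀ i j, r i j → r' i j) : Related e e' r' F' s s' :=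
  ⟨fun v hv => hr _ _ (h.rel v (hF hv)),
    fun v hv v' hv' => h.lt_iff v (hF hv) v' (hF hv')⟩

theorem Related.symm {e e' : ℕ → ℕ} {r r' : ℕ → ℕ → Prop} {F : Finset (Fin 2)}
    {s s' : Fin 2 → ℕ} (h : Related e e' r F s s') (hr : ∀ i j, r i j → r' j i) :
    Related e' e r' F s' s :=
  ⟨fun v hv => hr _ _ (h.rel v hv), fun v hv v' hv' => (h.lt_iff v hv v' hv').symm⟩

theorem Related.eq_iff {e e' : ℕ → ℕ} {r : ℕ → ℕ → Prop} {F : Finset (Fin 2)}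
    {s s' : Fin 2 → ℕ} (h : Related e e' r F s s') {v v' : Fin 2} (hv : v ∈ F) (hv' : v' ∈ F) :
    s v = s v' ↔ s' v = s' v' := by
  have h1 := h.lt_iff v hv v' hv'
  have h2 := h.lt_iff v' hv' v hv
  omega

/-- The duplicator answers a move of the pebble `v`. -/
theorem System.move {u : List A} {c K N : ℕ} {R : ℕ → ℕ → ℕ → ℕ → Prop}
    (h : System (fun i => u[i]?) c (Set.Iio u.length) K N R) {w w' : List A} {e e' : ℕ → ℕ}
    (he : Embeds u c w e) (he' : Embeds u c w' e') {k n : ℕ} (hk : k < K) (hn : n < N)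
    {F : Finset (Fin 2)} {s s' : Fin 2 → ℕ} (v : Fin 2)
    (hs : Related e e' (R k (n + 1)) (F.erase v) s s')
    {i : ℕ} (hi : i < w.length) :
    ∃ i' < w'.length, Related e e' (R k n) F (Function.update s v i) (Function.update s' v i') := by
  obtain ⟨o, hov, ho⟩ : ∃ o, o ≠ v ∧ ∀ x, x = v ∨ x = o := by
    have hfin : ∀ v : Fin 2, 1 - v ≠ v ∧ ∀ x, x = v ∨ x = 1 - v := by decide
    exact ⟨1 - v, hfin v⟩
  -- With two variables, the new pebble has to be compared only with the other pebble `o`, and only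
  -- if `o` is free.
  have key : ∃ i' < w'.length, R k n (e i) (e' i') ∧
      (o ∈ F → (i < s o ↔ i' < s' o) ∧ (s o < i ↔ s' o < i')) := by
    by_cases hoF : o ∈ F
    · have hr := hs.rel o (Finset.mem_erase.2 ⟨hov, hoF⟩)
      obtain ⟨hd1, hd2, -⟩ := h.dom _ _ _ _ hk hr
      rcases lt_trichotomy i (s o) with hlt | heq | hgt
      · obtain ⟨j, h1, h2, h3⟩ := h.left k n _ _ hk hn hr (e i) (he.lt_length i hi)
          (he.strictMono hlt)
        obtain ⟨i', h4, rfl⟩ := he'.surj j (h.dom _ _ _ _ hk h3).2.1 h2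
        have h5 := he'.strictMono.lt_iff_lt.1 h1
        exact ⟨i', h4, h3, fun _ => ⟨by omega, by omega⟩⟩
      · exact ⟨s' o, he'.lt_of_lt hd2, heq ▸ h.mono _ _ _ _ hk hn hr,
          fun _ => ⟨by omega, by omega⟩⟩
      · obtain ⟨j, h1, h2, h3⟩ := h.right k n _ _ hk hn hr (e i) (he.lt_length i hi)
          (he.strictMono hgt)
        obtain ⟨i', h4, rfl⟩ := he'.surj j (h.dom _ _ _ _ hk h3).2.1 h2
        have h5 := he'.strictMono.lt_iff_lt.1 h1
        exact ⟨i', h4, h3, fun _ => ⟨by omega, by omega⟩⟩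
    · obtain ⟨j, h2, h3⟩ := h.start k n hk hn (e i) (he.lt_length i hi)
      obtain ⟨i', h4, rfl⟩ := he'.surj j (h.dom _ _ _ _ hk h3).2.1 h2
      exact ⟨i', h4, h3, fun h => absurd h hoF⟩
  obtain ⟨i', hi', hR, hord⟩ := key
  refine ⟨i', hi', ?_, ?_⟩
  · intro x hx
    rcases ho x with rfl | rfl
    · simpa using hR
    · simpa [hov] using h.mono _ _ _ _ hk hn (hs.rel x (Finset.mem_erase.2 ⟨hov, hx⟩))
  · intro x hx y hy
    rcases ho x with rfl | rfl <;> rcases ho y with rfl | rfl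
    · simp
    · simpa [hov] using (hord hy).1
    · simpa [hov] using (hord hx).2
    · simp

/-- Formulas with at most `k` blocks after an initial block of existential quantifiers are preserved
along the relation at level `k`. -/
theorem System.transfer {u : List A} {c K N : ℕ} {R : ℕ → ℕ → ℕ → ℕ → Prop}
    (h : System (fun i => u[i]?) c (Set.Iio u.length) K N R) (φ : Formula A) :
    ∀ {w w' : List A} {e e' : ℕ → ℕ}, Embeds u c w e → Embeds u c w' e' →
    ∀ {k n : ℕ}, k < K → n ≤ N → φ.depth ≤ n → ∀ {s s' : Fin 2 → ℕ},
    Related e e' (R k n) φ.freeVars s s' →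
    (φ.blocksAux true (some true) ≤ k → φ.Realize w s → φ.Realize w' s') ∧
    (φ.blocksAux false (some true) ≤ k → φ.Realize w' s' → φ.Realize w s) := by
  induction φ with
  | letter a v =>
    intro w w' e e' he he' k n hk hn hd s s' hs
    have := (h.dom _ _ _ _ hk (hs.rel v (by simp [Formula.freeVars]))).2.2
    simp only [Formula.Realize, he.letter, he'.letter, this]
    tauto
  | lt v v' =>
    intro w w' e e' he he' k n hk hn hd s s' hs
    have := hs.lt_iff v (by simp [Formula.freeVars]) v' (by simp [Formula.freeVars])
    simp only [Formula.Realize, this]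
    tauto
  | eq v v' =>
    intro w w' e e' he he' k n hk hn hd s s' hs
    have := hs.eq_iff (v := v) (v' := v') (by simp [Formula.freeVars]) (by simp [Formula.freeVars])
    simp only [Formula.Realize, this]
    tauto
  | neg φ ih =>
    intro w w' e e' he he' k n hk hn hd s s' hs
    obtain ⟨h1, h2⟩ := ih he he' hk hn hd hs
    exact ⟨fun hb hr hr' => hr (h2 hb hr'), fun hb hr hr' => hr (h1 hb hr')⟩
  | and φ ψ ih₁ ih₂ =>
    intro w w' e e' he he' k n hk hn hd s s' hs
    simp only [Formula.depth, max_le_iff] at hd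
    obtain ⟨h1, h2⟩ := ih₁ he he' hk hn hd.1 (hs.mono Finset.subset_union_left fun _ _ h => h)
    obtain ⟨h3, h4⟩ := ih₂ he he' hk hn hd.2 (hs.mono Finset.subset_union_right fun _ _ h => h)
    simp only [Formula.blocksAux, max_le_iff]
    exact ⟨fun hb => And.imp (h1 hb.1) (h3 hb.2), fun hb => And.imp (h2 hb.1) (h4 hb.2)⟩
  | or φ ψ ih₁ ih₂ =>
    intro w w' e e' he he' k n hk hn hd s s' hs
    simp only [Formula.depth, max_le_iff] at hd
    obtain ⟨h1, h2⟩ := ih₁ he he' hk hn hd.1 (hs.mono Finset.subset_union_left fun _ _ h => h)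
    obtain ⟨h3, h4⟩ := ih₂ he he' hk hn hd.2 (hs.mono Finset.subset_union_right fun _ _ h => h)
    simp only [Formula.blocksAux, max_le_iff]
    exact ⟨fun hb => Or.imp (h1 hb.1) (h3 hb.2), fun hb => Or.imp (h2 hb.1) (h4 hb.2)⟩
  | ex v φ ih =>
    intro w w' e e' he he' k n hk hn hd s s' hs
    obtain ⟨n, rfl⟩ : ∃ n', n = n' + 1 := ⟨n - 1, by simp only [Formula.depth] at hd; omega⟩
    have hd' : φ.depth ≤ n := by simpa [Formula.depth] using hd
    constructor
    · rintro hb ⟨i, hi, hr⟩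
      obtain ⟨i', hi', hrel⟩ := h.move he he' hk hn v hs hi
      have hb' : φ.blocksAux true (some true) ≤ k := by simpa [Formula.blocksAux] using hb
      exact ⟨i', hi', (ih he he' hk (by omega) hd' hrel).1 hb' hr⟩
    · rintro hb ⟨i, hi, hr⟩
      -- Here the quantifier counts as universal and opens a new block. The two words swap roles
      -- through `flip`, one level is spent, and duality restores the normal form of the count.
      have hdual := φ.blocksAux_dual true (some true)
      simp only [Option.map_some, Bool.not_true] at hdual
      simp only [Formula.blocksAux, hdual, Option.some.injEq, Bool.true_eq_false, if_false] at hb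
      obtain ⟨k, rfl⟩ : ∃ k', k = k' + 1 := ⟨k - 1, by omega⟩
      obtain ⟨i', hi', hrel⟩ := h.move he' he (by omega) hn v
        (hs.symm fun _ _ hr => h.flip _ _ _ _ hk hn hr) hi
      exact ⟨i', hi', (ih he' he (by omega) (by omega) hd' hrel).1 (by omega) hr⟩
  | all v φ ih =>
    intro w w' e e' he he' k n hk hn hd s s' hs
    obtain ⟨n, rfl⟩ : ∃ n', n = n' + 1 := ⟨n - 1, by simp only [Formula.depth] at hd; omega⟩
    have hd' : φ.depth ≤ n := by simpa [Formula.depth] using hd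
    constructor
    · intro hb hr i hi
      have hdual := φ.blocksAux_dual false (some true)
      simp only [Option.map_some, Bool.not_true, Bool.not_false] at hdual
      simp only [Formula.blocksAux, hdual, Option.some.injEq, Bool.not_true, Bool.true_eq_false,
        if_false] at hb
      obtain ⟨k, rfl⟩ : ∃ k', k = k' + 1 := ⟨k - 1, by omega⟩
      obtain ⟨i', hi', hrel⟩ := h.move he' he (by omega) hn v
        (hs.symm fun _ _ hr => h.flip _ _ _ _ hk hn hr) hi
      exact (ih he' he (by omega) (by omega) hd' hrel).2 (by omega) (hr i' hi')
    · intro hb hr i hi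
      obtain ⟨i', hi', hrel⟩ := h.move he he' hk hn v hs hi
      have hb' : φ.blocksAux false (some true) ≤ k := by simpa [Formula.blocksAux] using hb
      exact (ih he he' hk (by omega) hd' hrel).2 hb' (hr _ ‹_›)

/-- Sentences with at most `K` blocks do not notice the missing position. -/
theorem System.models_iff {u : List A} {c K N : ℕ} {R : ℕ → ℕ → ℕ → ℕ → Prop}
    (h : System (fun i => u[i]?) c (Set.Iio u.length) K N R) {w : List A} {e : ℕ → ℕ}
    (he : Embeds u c w e) (φ : Formula A) (hφ : φ.IsSentence) (hd : φ.depth ≤ N)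
    (hb : φ.blocks ≤ K) : φ.Models u ↔ φ.Models w := by
  have vac : ∀ (ψ : Formula A), ψ.IsSentence → ∀ (e e' : ℕ → ℕ) r,
      Related e e' r ψ.freeVars (fun _ => 0) (fun _ => 0) := fun ψ hψ e e' r => by
    rw [hψ]
    exact ⟨by simp, by simp⟩
  induction φ with
  | letter a v => simp [Formula.IsSentence, Formula.freeVars] at hφ
  | lt v v' => simp [Formula.IsSentence, Formula.freeVars] at hφ
  | eq v v' => simp [Formula.IsSentence, Formula.freeVars] at hφ
  | neg φ ih =>
    exact not_congr (ih hφ hd ((φ.blocksAux_dual true none).symm.trans_le hb))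
  | and φ ψ ih₁ ih₂ =>
    simp only [Formula.IsSentence, Formula.freeVars, Finset.union_eq_empty] at hφ
    simp only [Formula.depth, max_le_iff] at hd
    simp only [Formula.blocks, Formula.blocksAux, max_le_iff] at hb
    exact and_congr (ih₁ hφ.1 hd.1 hb.1) (ih₂ hφ.2 hd.2 hb.2)
  | or φ ψ ih₁ ih₂ =>
    simp only [Formula.IsSentence, Formula.freeVars, Finset.union_eq_empty] at hφ
    simp only [Formula.depth, max_le_iff] at hd
    simp only [Formula.blocks, Formula.blocksAux, max_le_iff] at hb
    exact or_congr (ih₁ hφ.1 hd.1 hb.1) (ih₂ hφ.2 hd.2 hb.2)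
  | ex v φ ih =>
    simp only [Formula.blocks, Formula.blocksAux, reduceCtorEq, if_false] at hb
    -- The first block does not count as a change of sides, so level `K - 1` is enough.
    have hb' : (Formula.ex v φ).blocksAux true (some true) ≤ K - 1 := by
      simp only [Formula.blocksAux, if_true]
      omega
    have hid := embeds_id u c
    -- The same system serves both directions, since answers avoid `c` on either side.
    exact ⟨(h.transfer _ hid he (by omega) le_rfl hd (vac _ hφ _ _ _)).1 hb',
      (h.transfer _ he hid (by omega) le_rfl hd (vac _ hφ _ _ _)).1 hb'⟩
  | all v φ ih =>
    simp only [Formula.blocks, Formula.blocksAux, reduceCtorEq, if_false] at hb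
    have hdual := φ.blocksAux_dual false (some true)
    simp only [Option.map_some, Bool.not_true, Bool.not_false] at hdual
    have hb' : (Formula.all v φ).blocksAux false (some true) ≤ K - 1 := by
      simp only [Formula.blocksAux, Bool.not_false, if_true]
      simp only [Bool.not_true] at hb
      omega
    have hid := embeds_id u c
    exact ⟨(h.transfer _ he hid (by omega) le_rfl hd (vac _ hφ _ _ _)).2 hb',
      (h.transfer _ hid he (by omega) le_rfl hd (vac _ hφ _ _ _)).2 hb'⟩

theorem System.congr_label {α B C : Type*} [LinearOrder α] {ℓ : α → B} {ℓ' : α → C} {c : α}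
    {I : Set α} {K N : ℕ} {R : ℕ → ℕ → α → α → Prop} (h : System ℓ c I K N R)
    (hℓ : ∀ i j, ℓ i = ℓ j → ℓ' i = ℓ' j) : System ℓ' c I K N R where
  dom := fun k n i i' hk hr => ⟨(h.dom k n i i' hk hr).1, (h.dom k n i i' hk hr).2.1,
    hℓ _ _ (h.dom k n i i' hk hr).2.2⟩
  mono := h.mono
  flip := h.flip
  left := h.left
  right := h.right
  start := h.start

/-- The words `u_{m+1,N}` and `v_{m+1,N}` satisfy the same sentences of quantifier depth at most `N`
with at most `m` blocks. -/
theorem models_uWord_iff_vWord {m N : ℕ} {φ : Formula (Fin (m + 1))} (hφ : φ ∈ FO2Depth _ m N) :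
    φ.Models (uWord (m + 1) N) ↔ φ.Models (vWord (m + 1) N) := by
  obtain ⟨hs, hd, hb⟩ := hφ
  obtain ⟨X, Y, R, hu, hv, hR⟩ := exists_system_uNat m N
  obtain ⟨X', Z, hu', rfl, hZ⟩ := List.map_eq_append_iff.1 hu
  obtain ⟨a, Y', rfl, ha, rfl⟩ := List.map_eq_cons_iff.1 hZ
  have hv' : vWord (m + 1) N = X' ++ Y' := by
    refine List.map_injective_iff.2 Fin.val_injective ?_
    rw [List.map_append]
    exact hv
  rw [hv']
  have hR' : System (fun i => (uWord (m + 1) N)[i]?) X'.length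
      (Set.Iio (uWord (m + 1) N).length) m N R := by
    have := hR.congr_label (ℓ' := fun i => (uWord (m + 1) N)[i]?) fun i j hij => by
      simp only [uNat, List.getElem?_map] at hij
      exact Option.map_injective Fin.val_injective hij
    simpa [uNat] using this
  rw [hu'] at hR' ⊢
  exact hR'.models_iff (embeds_skip X' Y' a) φ hs hd hb

end Transfer

/-! ### The separating sentences and the strictness of the hierarchy. -/

section Separation

/-- The formula stating that the position `v` belongs to the factor `u_{m-d}` of `u_m`. -/
def blockFormula (m : ℕ) [NeZero m] : ℕ → Fin 2 → Formula (Fin m)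
  | 0, v => .eq v v
  | d + 1, v => .and (blockFormula m d v) (.all (1 - v)
      (.or (if Odd (m - d) then .lt (1 - v) v else .lt v (1 - v))
        (.or (.neg (.letter (Fin.ofNat m (m - (d + 1))) (1 - v)))
          (.neg (blockFormula m d (1 - v))))))

/-- The set of positions defined by `blockFormula`. -/
def InBlock (w : List ℕ) (m : ℕ) : ℕ → ℕ → Prop
  | 0, _ => True
  | d + 1, x => InBlock w m d x ∧ ∀ y < w.length,
      (if Odd (m - d) then y < x else x < y) ∨ (¬ w[y]? = some (m - (d + 1)) ∨ ¬ InBlock w m d y)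

theorem freeVars_blockFormula (m : ℕ) [NeZero m] (d : ℕ) (v : Fin 2) :
    (blockFormula m d v).freeVars ⊆ {v} := by
  induction d generalizing v with
  | zero => simp [blockFormula, Formula.freeVars]
  | succ d ih =>
    have hfin : ∀ v : Fin 2, ({v, 1 - v} : Finset (Fin 2)).erase (1 - v) ⊆ {v} ∧
        ({1 - v, v} : Finset (Fin 2)) = {v, 1 - v} := by decide
    refine Finset.union_subset (ih v) ((Finset.erase_subset_erase _ ?_).trans (hfin v).1)
    refine Finset.union_subset ?_ (Finset.union_subset ?_ ((ih (1 - v)).trans ?_))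
    · split_ifs
      · exact (hfin v).2.subset
      · exact subset_rfl
    · simp [Formula.freeVars]
    · simp

/-- Below the new universal quantifier the recursive copy is negated. By duality it costs as much as
the unnegated copy below an existential one, so each step adds a single block. -/
theorem blocksAux_blockFormula (m : ℕ) [NeZero m] (d : ℕ) (v : Fin 2) :
    (blockFormula m d v).blocksAux true (some true) ≤ d := by
  induction d generalizing v with
  | zero => simp [blockFormula, Formula.blocksAux]
  | succ d ih =>
    have hdual := (blockFormula m d (1 - v)).blocksAux_dual true (some true)
    simp only [Option.map_some, Bool.not_true] at hdual
    have h1 := ih v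
    have h2 := ih (1 - v)
    unfold blockFormula
    split_ifs <;> simp [Formula.blocksAux, hdual] <;> omega

theorem realize_blockFormula (m : ℕ) [NeZero m] (w : List (Fin m)) {d : ℕ} (hd : d ≤ m) (v : Fin 2)
    (s : Fin 2 → ℕ) :
    (blockFormula m d v).Realize w s ↔ InBlock (w.map Fin.val) m d (s v) := by
  induction d generalizing v s with
  | zero => simp [blockFormula, Formula.Realize, InBlock]
  | succ d ih =>
    have hne : ∀ v : Fin 2, v ≠ 1 - v := by decide
    have hletter : ∀ y : ℕ, w[y]? = some (Fin.ofNat m (m - (d + 1))) ↔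
        (w.map Fin.val)[y]? = some (m - (d + 1)) := fun y => by
      rw [List.getElem?_map, ← (Option.map_injective Fin.val_injective).eq_iff, Option.map_some,
        Fin.val_ofNat, Nat.mod_eq_of_lt (by omega)]
    simp only [blockFormula, Formula.Realize, InBlock, ih (by omega), List.length_map]
    refine and_congr_right fun _ => forall₂_congr fun y _ => or_congr ?_ (or_congr ?_ ?_)
    · split_ifs <;> simp [Formula.Realize, Function.update_of_ne (hne v)]
    · rw [← hletter, Function.update_self]
    · rw [Function.update_self]

/-- If the words `f j` are built by adding pads that meet the old word in the letter `j`, then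
`InBlock` picks out the factor `f (m - d)` of `f m`. -/
theorem inBlock_iff {f : ℕ → List ℕ} {m : ℕ}
    (hodd : ∀ j, 1 ≤ j → j < m → Odd (j + 1) → ∃ T, f (j + 1) = T ++ j :: f j)
    (heven : ∀ j, 1 ≤ j → j < m → ¬ Odd (j + 1) → ∃ T, f (j + 1) = f j ++ j :: T)
    (hmem : ∀ j, j ∉ f j) {d : ℕ} (hd : d < m) :
    ∃ P S, f m = P ++ f (m - d) ++ S ∧ ∀ x < (f m).length,
      InBlock (f m) m d x ↔ P.length ≤ x ∧ x < P.length + (f (m - d)).length := by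
  induction d with
  | zero => exact ⟨[], [], by simp, fun x hx => by simpa [InBlock] using hx⟩
  | succ d ih =>
    obtain ⟨P, S, hw, hB⟩ := ih (by omega)
    obtain ⟨j, hj, hj1⟩ : ∃ j, m - (d + 1) = j ∧ m - d = j + 1 := ⟨_, rfl, by omega⟩
    rw [hj1] at hw hB
    rw [hj]
    simp only [InBlock, hj, hj1]
    have hlen : (f m).length = P.length + (f (j + 1)).length + S.length := by simp [hw, add_assoc]
    by_cases ho : Odd (j + 1)
    · obtain ⟨T, hT⟩ := hodd j (by omega) (by omega) ho
      have hTl : (f (j + 1)).length = T.length + ((f j).length + 1) := by simp [hT]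
      refine ⟨P ++ T ++ [j], S, by rw [hw, hT]; simp, fun x hx => ?_⟩
      rw [hB x hx, List.length_append, List.length_append, List.length_singleton]
      simp only [if_pos ho]
      constructor
      · rintro ⟨h1, h2⟩
        refine ⟨?_, by omega⟩
        -- This is the last letter of the pad, the occurrence of `j` adjacent to `f j`; it forces
        -- `x` out of the pad.
        have h3 := h2 (P.length + T.length) (by omega)
        rw [hB _ (by omega)] at h3
        have h4 : (f m)[P.length + T.length]? = some j := by
          rw [hw, hT, show P ++ (T ++ j :: f j) ++ S = (P ++ T) ++ j :: (f j ++ S) by simp,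
            ← List.length_append, List.getElem?_append_right le_rfl]
          simp
        simp only [h4, not_true, false_or] at h3
        omega
      · rintro ⟨h1, h2⟩
        refine ⟨by omega, fun y hy => ?_⟩
        by_contra! hcon
        obtain ⟨h3, h4, h5⟩ := hcon
        rw [hB y hy] at h5
        have hw' : f m = (P ++ T ++ [j]) ++ f j ++ S := by rw [hw, hT]; simp
        -- An offending `y` would be an occurrence of `j` inside `f j`, against `hmem`.
        obtain ⟨b, hb, hb'⟩ := exists_mem_getElem? (P ++ T ++ [j]) (f j) S (i := y)
          (by simp; omega) (by simp; omega)
        rw [← hw', h4, Option.some.injEq] at hb'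
        exact hmem j (hb' ▸ hb)
    · obtain ⟨T, hT⟩ := heven j (by omega) (by omega) ho
      have hTl : (f (j + 1)).length = T.length + ((f j).length + 1) := by simp [hT]; omega
      refine ⟨P, j :: T ++ S, by rw [hw, hT]; simp, fun x hx => ?_⟩
      rw [hB x hx]
      simp only [if_neg ho]
      constructor
      · rintro ⟨h1, h2⟩
        refine ⟨by omega, ?_⟩
        have h3 := h2 (P.length + (f j).length) (by omega)
        rw [hB _ (by omega)] at h3
        have h4 : (f m)[P.length + (f j).length]? = some j := by
          rw [hw, hT, show P ++ (f j ++ j :: T) ++ S = (P ++ f j) ++ j :: (T ++ S) by simp,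
            ← List.length_append, List.getElem?_append_right le_rfl]
          simp
        simp only [h4, not_true, false_or] at h3
        omega
      · rintro ⟨h1, h2⟩
        refine ⟨by omega, fun y hy => ?_⟩
        by_contra! hcon
        obtain ⟨h3, h4, h5⟩ := hcon
        rw [hB y hy] at h5
        have hw' : f m = P ++ f j ++ (j :: T ++ S) := by rw [hw, hT]; simp
        obtain ⟨b, hb, hb'⟩ := exists_mem_getElem? P (f j) (j :: T ++ S) (i := y)
          (by omega) (by omega)
        rw [← hw', h4, Option.some.injEq] at hb'
        exact hmem j (hb' ▸ hb)

theorem rep_range_eq_append {n : ℕ} (hn : 1 ≤ n) (j : ℕ) :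
    ∃ T, rep n (List.range (j + 1)) = T ++ [j] := by
  obtain ⟨n, rfl⟩ : ∃ n', n = n' + 1 := ⟨n - 1, by omega⟩
  exact ⟨rep n (List.range (j + 1)) ++ List.range j, by
    rw [rep_succ', List.append_assoc, ← List.range_succ]⟩

theorem rep_range_reverse_eq_cons {n : ℕ} (hn : 1 ≤ n) (j : ℕ) :
    ∃ T, rep n (List.range (j + 1)).reverse = j :: T := by
  obtain ⟨n, rfl⟩ : ∃ n', n = n' + 1 := ⟨n - 1, by omega⟩
  exact ⟨(List.range j).reverse ++ rep n (List.range (j + 1)).reverse, by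
    rw [rep_succ, ← List.cons_append]
    congr 1
    simp [List.range_succ]⟩

/-- Stated for a general `f` to cover `u` and `v` at once: they follow the same recursion and differ
only in `f 1`. -/
theorem exists_inBlock_iff {f : ℕ → List ℕ} {n : ℕ} (hn : 1 ≤ n)
    (htwo : f 2 = f 1 ++ rep (2 * n) [1, 0])
    (hsucc : ∀ k, f (k + 3) = if Odd (k + 3) then rep n (List.range (k + 3)) ++ f (k + 2)
      else f (k + 2) ++ rep n (List.range (k + 3)).reverse)
    (hmem : ∀ j, j ∉ f j) {m : ℕ} (hm : 1 ≤ m) :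
    (∃ x < (f m).length, InBlock (f m) m (m - 1) x) ↔ f 1 ≠ [] := by
  obtain ⟨P, S, hw, hB⟩ := inBlock_iff (f := f) (m := m) (d := m - 1)
    (fun j hj _ ho => by
      obtain ⟨k, rfl⟩ | rfl : (∃ k, j = k + 2) ∨ j = 1 := by
        by_cases h : j = 1
        · exact Or.inr h
        · exact Or.inl ⟨j - 2, by omega⟩
      · obtain ⟨T, hT⟩ := rep_range_eq_append hn (k + 2)
        exact ⟨T, by rw [hsucc, if_pos ho, hT]; simp⟩
      · exact absurd ho (by decide))
    (fun j hj _ ho => by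
      obtain ⟨k, rfl⟩ | rfl : (∃ k, j = k + 2) ∨ j = 1 := by
        by_cases h : j = 1
        · exact Or.inr h
        · exact Or.inl ⟨j - 2, by omega⟩
      · obtain ⟨T, hT⟩ := rep_range_reverse_eq_cons hn (k + 2)
        exact ⟨T, by rw [hsucc, if_neg ho, hT]⟩
      -- The word `[1, 0]` is the reversed range of length 2, so the pad of `f 2` has the general
      -- shape.
      · obtain ⟨T, hT⟩ := rep_range_reverse_eq_cons (n := 2 * n) (by omega) 1
        exact ⟨T, by rw [htwo, ← hT]; rfl⟩)
    hmem (by omega)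
  rw [show m - (m - 1) = 1 by omega] at hw hB
  have hlen : (f m).length = P.length + (f 1).length + S.length := by simp [hw, add_assoc]
  rw [← List.length_pos_iff]
  constructor
  · rintro ⟨x, hx, h⟩
    rw [hB x hx] at h
    omega
  · intro h
    exact ⟨P.length, by omega, (hB _ (by omega)).2 ⟨le_rfl, by omega⟩⟩

theorem exists_separating (m : ℕ) (hm : 1 ≤ m) :
    ∃ φ ∈ FO2Alt (Fin m) m, (∀ w ∈ langK m, φ.Models w) ∧ (∀ w ∈ langL m, ¬ φ.Models w) := by
  have : NeZero m := ⟨by omega⟩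
  have hmodels : ∀ w : List (Fin m), (Formula.ex 0 (blockFormula m (m - 1) 0)).Models w ↔
      ∃ x < (w.map Fin.val).length, InBlock (w.map Fin.val) m (m - 1) x := fun w => by
    simp [Formula.Models, Formula.Realize, realize_blockFormula m w (Nat.sub_le m 1)]
  refine ⟨.ex 0 (blockFormula m (m - 1) 0), ?_, ?_, ?_⟩
  · simp only [FO2Alt, Set.mem_iUnion]
    refine ⟨max m (Formula.ex 0 (blockFormula m (m - 1) 0)).depth, le_max_left _ _, ?_,
      le_max_right _ _, ?_⟩
    · refine Finset.subset_empty.1 ((Finset.erase_subset_erase 0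
        (freeVars_blockFormula m (m - 1) 0)).trans ?_)
      simp
    · have := blocksAux_blockFormula m (m - 1) 0
      simp only [Formula.blocks, Formula.blocksAux, reduceCtorEq, if_false]
      omega
  · rintro w ⟨n, hn, rfl⟩
    rw [hmodels]
    exact (exists_inBlock_iff (f := fun j => uNat j n) hn (uNat_two n) (fun k => uNat_succ k n)
      (fun j hj => lt_irrefl j (lt_of_mem_uNat hj)) hm).2 (by simp [uNat, uWord])
  · rintro w ⟨n, hn, rfl⟩
    rw [hmodels]
    exact fun h => (exists_inBlock_iff (f := fun j => vNat j n) hn (vNat_two n)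
      (fun k => vNat_succ k n) (fun j hj => lt_irrefl j (lt_of_mem_vNat hj)) hm).1 h
        (by simp [vNat, vWord])

theorem not_separates (m : ℕ) (hm : 1 ≤ m) {ψ : Formula (Fin m)} (hψ : ψ ∈ FO2Alt (Fin m) (m - 1)) :
    ¬ Separates ψ (langK m) (langL m) := by
  obtain ⟨m, rfl⟩ : ∃ m', m = m' + 1 := ⟨m - 1, by omega⟩
  simp only [FO2Alt, Set.mem_iUnion] at hψ
  obtain ⟨n, -, hs, hd, hb⟩ := hψ
  -- The index `n + 1` ensures that the words belong to the two languages even for `n = 0`.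
  have key := models_uWord_iff_vWord (m := m) (N := n + 1) ⟨hs, hd.trans n.le_succ, hb⟩
  have hu : uWord (m + 1) (n + 1) ∈ langK (m + 1) := ⟨n + 1, by omega, rfl⟩
  have hv : vWord (m + 1) (n + 1) ∈ langL (m + 1) := ⟨n + 1, by omega, rfl⟩
  rintro (⟨h1, h2⟩ | ⟨h1, h2⟩)
  · exact h2 _ hv (key.1 (h1 _ hu))
  · exact h1 _ hu (key.2 (h2 _ hv))

theorem definable_mono (A : Type) {m m' : ℕ} (h : m ≤ m') : Definable A m ⊆ Definable A m' := by
  rintro L ⟨φ, hφ, hL⟩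
  refine ⟨φ, ?_, hL⟩
  simp only [FO2Alt, Set.mem_iUnion] at hφ ⊢
  obtain ⟨n, -, hs, hd, hb⟩ := hφ
  exact ⟨max n m', le_max_right _ _, hs, hd.trans (le_max_left _ _), hb.trans h⟩

end Separation

end FO2

theorem mainTheorem3 (m : ℕ) (hm : 1 ≤ m) :
    (∃ φ ∈ FO2.FO2Alt (Fin m) m, FO2.Separates φ (FO2.langK m) (FO2.langL m)) ∧
    (∀ ψ ∈ FO2.FO2Alt (Fin m) (m - 1), ¬ FO2.Separates ψ (FO2.langK m) (FO2.langL m)) ∧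
    FO2.Definable (Fin m) (m - 1) ⊂ FO2.Definable (Fin m) m := by
  obtain ⟨φ, hφ, hK, hL⟩ := FO2.exists_separating m hm
  refine ⟨⟨φ, hφ, Or.inl ⟨hK, hL⟩⟩, fun ψ hψ => FO2.not_separates m hm hψ,
    FO2.definable_mono _ (Nat.sub_le m 1), fun hsub => ?_⟩
  -- A sentence one level lower defining the language of `φ` would itself separate the two
  -- languages.
  obtain ⟨ψ, hψ, hdef⟩ := hsub (show ({w | φ.Models w} : Language (Fin m)) ∈ FO2.Definable (Fin m) m
    from ⟨φ, hφ, fun w => Iff.rfl⟩)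
  exact FO2.not_separates m hm hψ
    (Or.inl ⟨fun w hw => (hdef w).1 (hK w hw), fun w hw h => hL w hw ((hdef w).2 h)⟩)
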